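/- **Theorem (robustness of dissipative quantum computation to arbitrary noise).** Let $U_1,\dots,U_T$ be unitaries on $N\ge 1$ qubits, $T\ge 2$. On the computational register $(\mathbb C^2)^{\otimes N}$ together with a clock register $\mathbb C^{T+1}$, let $\mathcal D(\rho)=\sum_\alpha D_\alpha\rho D_\alpha^\dagger$ be the map with Kraus operators $$D^{\mathrm{init}}_a=\tfrac1{\sqrt2}|0\cdots0\rangle\langle a|\otimes|0\rangle\langle 0|,\qquad D^{\mathrm{fin}}=\tfrac1{\sqrt2}\,\mathbb 1\otimes|T\rangle\langle T|,$$ $$D^{\mathrm{prop}}_t=\tfrac1{\sqrt2}\big(U_{t+1}\otimes|t+1\rangle\langle t|+U_{t+1}^\dagger\otimes|t\rangle\langle t+1|\big),$$ where $a\in\{0,1\}^N$ and $t\in\{0,\dots,T-1\}$. Let $|\psi_t\rangle=U_t\cdots U_1|0\cdots0\rangle$ and $\rho_\infty=\frac1{T+1}\sum_{t=0}^T|\psi_t\rangle\langle\psi_t|\otimes|t\rangle\langle t|$ (the stationary state of $\mathcal D$). Fix an output qubit of the computational register and its correct value $b\in\{0,1\}$. Let $P=\mathbb 1\otimes|T\rangle\langle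 T|$, let $Q$ be the projector onto the outcome $\bar b$ (the wrong value) of measuring the output qubit, and for a density matrix $\rho$ with $\operatorname{tr}(P\rho)>0$ let $$p_{\mathrm{err}}(\rho)=\operatorname{tr}\Big(Q\,\frac{P\rho}{\operatorname{tr}(P\rho)}\Big)$$ be the probability of error given that the clock is measured to be $T$. Assume that the noiseless computation has bounded error: $p_{\mathrm{err}}(\rho_\infty)\le\frac13$. Then for every $\eta>0$ there are constants $c,K>0$, depending only on $\eta$ (and not on $N$, $T$, the unitaries, the output qubit or $b$), such that the following holds. Let $\widetilde{\mathcal D}$ be any completely positive trace-preserving map on the same space with $$\|\mathcal D-\widetilde{\mathcal D}\|_{1\to1}\le\delta\le\frac{c}{N\,T^3\log T},$$ where $\|\cdot\|_{1\to1}$ is the norm induced by the trace norm. Then 1. for every initial density matrix $\rho$ and every integer $m\ge K\,N\,T^2\log T$, $\operatorname{tr}\big(P\,\widetilde{\mathcal D}^m(\rho)\big)>0$ and $p_{\mathrm{err}}\big(\widetilde{\mathcal D}^m(\rho)\big)\le\frac13+\eta$; 2. every density matrix $\widetilde\rho$ with $\widetilde{\mathcal D}(\widetilde\rho)=\widetilde\rho$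 satisfies $\operatorname{tr}(P\widetilde\rho)>0$ and $p_{\mathrm{err}}(\widetilde\rho)\le\frac13+\eta$. -/

import Mathlib

open scoped Kronecker ENNReal ComplexOrder

noncomputable section

namespace DQC

/-- The Schatten `1`-norm (trace norm): the sum of the singular values of `A`, i.e. of the square
roots of the eigenvalues of `Aᴴ * A`, counted with multiplicity. -/
def traceNorm {n : Type*} [Fintype n] [DecidableEq n] (A : Matrix n n ℂ) : ℝ :=
  ∑ i, Real.sqrt ((Matrix.isHermitian_conjTranspose_mul_self A).eigenvalues i)

/-- The induced norm `‖Φ‖_{1 → 1} = sup_{X ≠ 0} ‖Φ X‖₁ / ‖X‖₁` of a linear map on matrices, the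
supremum being over all complex matrices. It is taken in `[0, ∞]` so that no boundedness
convention is involved. -/
def norm1to1 {n : Type*} [Fintype n] [DecidableEq n]
    (Φ : Matrix n n ℂ →ₗ[ℂ] Matrix n n ℂ) : ℝ≥0∞ :=
  ⨆ (X : Matrix n n ℂ) (_ : X ≠ 0), ENNReal.ofReal (traceNorm (Φ X) / traceNorm X)

/-- A density matrix: positive semidefinite of trace one. -/
def IsDensity {n : Type*} [Fintype n] (ρ : Matrix n n ℂ) : Prop :=
  ρ.PosSemidef ∧ ρ.trace = 1

/-- The ampliation `id_k ⊗ Φ`, acting on `k × k` block matrices by applying `Φ` to each block. -/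
def ampliation {n : Type*} (k : ℕ) (Φ : Matrix n n ℂ →ₗ[ℂ] Matrix n n ℂ)
    (M : Matrix (Fin k × n) (Fin k × n) ℂ) : Matrix (Fin k × n) (Fin k × n) ℂ :=
  Matrix.of fun x y => Φ (Matrix.of fun a b => M (x.1, a) (y.1, b)) x.2 y.2

/-- Completely positive, trace-preserving maps. -/
structure IsCPTP {n : Type*} [Fintype n] (Φ : Matrix n n ℂ →ₗ[ℂ] Matrix n n ℂ) : Prop where
  completelyPositive : ∀ (k : ℕ) (M : Matrix (Fin k × n) (Fin k × n) ℂ),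
    M.PosSemidef → (ampliation k Φ M).PosSemidef
  tracePreserving : ∀ X : Matrix n n ℂ, (Φ X).trace = X.trace

/-- The linear map `ρ ↦ K ρ K†`. -/
def conjMap {n : Type*} [Fintype n] (K : Matrix n n ℂ) : Matrix n n ℂ →ₗ[ℂ] Matrix n n ℂ where
  toFun ρ := K * ρ * K.conjTranspose
  map_add' X Y := by rw [Matrix.mul_add, Matrix.add_mul]
  map_smul' c X := by simp

/-- Computational basis labels of `N` qubits. -/
abbrev Bits (N : ℕ) : Type := Fin N → Bool

/-- The all-zeros label. -/
def zeroBits (N : ℕ) : Bits N := fun _ => false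

/-- Basis labels of the computational register (`N` qubits) together with the clock register
(one qudit of dimension `T + 1`). -/
abbrev Reg (N T : ℕ) : Type := Bits N × Fin (T + 1)

/-- A circuit `U_T ⋯ U_1` of `T` unitaries on `N` qubits; the gate `U_{t+1}` is `U t`,
for `t = 0, …, T - 1`. -/
abbrev Circuit (N T : ℕ) : Type := Fin T → Matrix.unitaryGroup (Bits N) ℂ

/-- `D^init_a = 2^{-1/2} |0…0⟩⟨a| ⊗ |0⟩⟨0|`. -/
def krausInit (N T : ℕ) (a : Bits N) : Matrix (Reg N T) (Reg N T) ℂ :=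
  ((1 / Real.sqrt 2 : ℝ) : ℂ) •
    (Matrix.single (zeroBits N) a (1 : ℂ) ⊗ₖ Matrix.single (0 : Fin (T + 1)) 0 (1 : ℂ))

/-- `D^fin = 2^{-1/2} 𝟙 ⊗ |T⟩⟨T|`. -/
def krausFin (N T : ℕ) : Matrix (Reg N T) (Reg N T) ℂ :=
  ((1 / Real.sqrt 2 : ℝ) : ℂ) •
    ((1 : Matrix (Bits N) (Bits N) ℂ) ⊗ₖ Matrix.single (Fin.last T) (Fin.last T) (1 : ℂ))

/-- `D^prop_t = 2^{-1/2} (U_{t+1} ⊗ |t+1⟩⟨t| + U_{t+1}† ⊗ |t⟩⟨t+1|)`. -/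
def krausProp {N T : ℕ} (U : Circuit N T) (t : Fin T) : Matrix (Reg N T) (Reg N T) ℂ :=
  ((1 / Real.sqrt 2 : ℝ) : ℂ) •
    ((U t : Matrix (Bits N) (Bits N) ℂ) ⊗ₖ Matrix.single t.succ t.castSucc (1 : ℂ)
      + (U t : Matrix (Bits N) (Bits N) ℂ).conjTranspose ⊗ₖ
          Matrix.single t.castSucc t.succ (1 : ℂ))

/-- The discrete-time dissipative quantum computation map `𝓓` of the circuit `U`. -/
def dqcMap {N T : ℕ} (U : Circuit N T) :
    Matrix (Reg N T) (Reg N T) ℂ →ₗ[ℂ] Matrix (Reg N T) (Reg N T) ℂ :=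
  (∑ a : Bits N, conjMap (krausInit N T a)) + conjMap (krausFin N T)
    + ∑ t : Fin T, conjMap (krausProp U t)

/-- The product `U_t ⋯ U_1` of the first `t` gates. -/
def partialCircuit {N T : ℕ} (U : Circuit N T) (t : Fin (T + 1)) :
    Matrix (Bits N) (Bits N) ℂ :=
  Fin.induction (motive := fun _ => Matrix (Bits N) (Bits N) ℂ) 1
    (fun s V => (U s : Matrix (Bits N) (Bits N) ℂ) * V) t

/-- `|ψ_t⟩ = U_t ⋯ U_1 |0…0⟩`. -/
def psi {N T : ℕ} (U : Circuit N T) (t : Fin (T + 1)) : Bits N → ℂ :=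
  (partialCircuit U t).mulVec (Pi.single (zeroBits N) 1)

/-- `ρ_∞ = (T + 1)⁻¹ ∑_t |ψ_t⟩⟨ψ_t| ⊗ |t⟩⟨t|`. -/
def rhoInfty {N T : ℕ} (U : Circuit N T) : Matrix (Reg N T) (Reg N T) ℂ :=
  ((T : ℂ) + 1)⁻¹ •
    ∑ t : Fin (T + 1), Matrix.vecMulVec (psi U t) (star (psi U t)) ⊗ₖ Matrix.single t t (1 : ℂ)

/-- The projector `P = 𝟙 ⊗ |T⟩⟨T|` onto clock value `T`. -/
def clockProj (N T : ℕ) : Matrix (Reg N T) (Reg N T) ℂ :=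
  (1 : Matrix (Bits N) (Bits N) ℂ) ⊗ₖ Matrix.single (Fin.last T) (Fin.last T) (1 : ℂ)

/-- The projector onto the outcome `v` of measuring qubit `j` of the computational register. -/
def outcomeProj {N : ℕ} (T : ℕ) (j : Fin N) (v : Bool) : Matrix (Reg N T) (Reg N T) ℂ :=
  (Matrix.diagonal fun x : Bits N => if x j = v then (1 : ℂ) else 0) ⊗ₖ
    (1 : Matrix (Fin (T + 1)) (Fin (T + 1)) ℂ)

/-- The probability `tr (P ρ)` of reading `T` on the clock register. -/
def clockProb {N T : ℕ} (ρ : Matrix (Reg N T) (Reg N T) ℂ) : ℝ :=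
  (clockProj N T * ρ).trace.re

/-- The error probability `tr (Q · P ρ / tr (P ρ))`, conditional on reading `T` on the clock, when
the correct value of the output qubit `j` is `b`; here `Q` projects onto the outcome `!b`. -/
def errorProb {N T : ℕ} (j : Fin N) (b : Bool) (ρ : Matrix (Reg N T) (Reg N T) ℂ) : ℝ :=
  (outcomeProj T j (!b) *
    ((clockProj N T * ρ).trace⁻¹ • (clockProj N T * ρ))).trace.re

end DQC

end

/-! Only the diagonal clock blocks matter, and `dqcMap U` acts on them autonomously. Undo the first
`t` gates in block `t` and test with an effect `E` on the qubits. The resulting numbers `u t`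
perform a simple random walk on the clock, reflected at `T`; at clock value `0`, half of the weight
is reset to the all-zeros state (`blockObs_dqcMap`). For `E = 1` this is the walk reflected at both
ends, with clock distribution `p t`.

Let `e` be the expectation of `E` in the all-zeros state. In `u - e * p` the reset term cancels, so
this difference is a walk killed at `0`, and it decays; meanwhile `p` equidistributes. Explicit
concave weights whose discrete Laplacian is `-1` give both rates, of order `1 - 1 / T ^ 2`. Hence
after order `T ^ 2 * log T` steps, uniformly in `N`, the observables at clock value `T` are within a
small multiple of `1 / T` of their values `e / (T + 1)` and `1 / (T + 1)` in the state `rhoInfty U`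
(`abs_blockObs_dqcMap_pow_sub_le`).

Noise enters by a hybrid argument: exchanging one noisy step for a noiseless one costs at most `δ`,
so `m₀` steps cost `m₀ * δ` (`abs_blockObs_pow_sub_le`). Only the last `m₀` steps, of order `T ^ 2 *
log T`, are compared, and everything earlier counts as preparation of another initial state. With
`δ` of order `1 / (T ^ 3 * log T)` the cost is again a small multiple of `1 / T`, which is what a
ratio of two quantities of size `1 / T` tolerates. -/

namespace DQC

/-! ### Trace norm and positive functionals -/

section TraceNorm

open scoped MatrixOrder Matrix.Norms.L2Operator

variable {n : Type*} [Fintype n] [DecidableEq n]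

/-- Identifies the singular-value sum with the trace of the functional-calculus absolute value,
which makes the positivity of `|A| ± A` available. -/
lemma trace_abs_eq_traceNorm (A : Matrix n n ℂ) :
    (CFC.abs A).trace = (traceNorm A : ℂ) := by
  have hA := Matrix.isHermitian_conjTranspose_mul_self A
  have h0 : (0 : Matrix n n ℂ) ≤ A.conjTranspose * A :=
    Matrix.nonneg_iff_posSemidef.mpr (Matrix.posSemidef_conjTranspose_mul_self A)
  have h1 : CFC.abs A = hA.cfc Real.sqrt := by
    rw [← hA.cfc_eq]
    exact (CFC.sqrt_eq_real_sqrt _ h0).trans (cfcₙ_eq_cfc (by fun_prop) (by simp))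
  rw [h1, Matrix.IsHermitian.cfc, Unitary.conjStarAlgAut_apply, Matrix.trace_mul_cycle,
    Unitary.coe_star_mul_self, one_mul, Matrix.trace_diagonal, traceNorm]
  simp

lemma traceNorm_eq_trace_of_posSemidef {A : Matrix n n ℂ} (hA : A.PosSemidef) :
    (traceNorm A : ℂ) = A.trace := by
  rw [← trace_abs_eq_traceNorm, CFC.abs_of_nonneg A (Matrix.nonneg_iff_posSemidef.mpr hA)]

/-- A positive functional dominated by the trace is bounded by the trace norm on Hermitian
matrices. -/
lemma abs_le_traceNorm_of_isHermitian {A : Matrix n n ℂ} (hA : A.IsHermitian)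
    (L : Matrix n n ℂ →ₗ[ℝ] ℝ) (h0 : ∀ X : Matrix n n ℂ, X.PosSemidef → 0 ≤ L X)
    (h1 : ∀ X : Matrix n n ℂ, X.PosSemidef → L X ≤ X.trace.re) :
    |L A| ≤ traceNorm A := by
  have hs : IsSelfAdjoint A := hA
  have hp := h0 _ (Matrix.nonneg_iff_posSemidef.mp (CFC.abs_nonneg A))
  have hq := h1 _ (Matrix.nonneg_iff_posSemidef.mp (CFC.abs_nonneg A))
  -- Since `|A| - A` and `|A| + A` are positive, `|L A| ≤ L |A| ≤ tr |A|`.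
  have ha : (CFC.abs A - A).PosSemidef := by
    rw [CFC.abs_sub_self A hs]
    exact Matrix.nonneg_iff_posSemidef.mp (smul_nonneg (by norm_num) (CFC.negPart_nonneg A))
  have hb : (CFC.abs A + A).PosSemidef := by
    rw [CFC.abs_add_self A hs]
    exact Matrix.nonneg_iff_posSemidef.mp (smul_nonneg (by norm_num) (CFC.posPart_nonneg A))
  have h2 := h0 _ ha
  have h3 := h0 _ hb
  rw [map_sub] at h2
  rw [map_add] at h3
  rw [trace_abs_eq_traceNorm, Complex.ofReal_re] at hq
  rw [abs_le]
  constructor <;> linarith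

end TraceNorm

/-- A bound on `norm1to1` is a pointwise bound on density matrices. -/
lemma traceNorm_apply_le {n : Type*} [Fintype n] [DecidableEq n]
    {Φ : Matrix n n ℂ →ₗ[ℂ] Matrix n n ℂ} {δ : ℝ} (hδ : 0 ≤ δ)
    (h : norm1to1 Φ ≤ ENNReal.ofReal δ) {ρ : Matrix n n ℂ} (hρ : IsDensity ρ) :
    traceNorm (Φ ρ) ≤ δ := by
  have hne : ρ ≠ 0 := by
    rintro rfl
    simpa using hρ.2
  have h1 : traceNorm ρ = 1 := by
    have := traceNorm_eq_trace_of_posSemidef hρ.1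
    rw [hρ.2] at this
    exact_mod_cast this
  have h2 : ENNReal.ofReal (traceNorm (Φ ρ) / traceNorm ρ) ≤ ENNReal.ofReal δ :=
    (le_iSup₂ (f := fun (X : Matrix n n ℂ) (_ : X ≠ 0) =>
      ENNReal.ofReal (traceNorm (Φ X) / traceNorm X)) ρ hne).trans h
  rw [h1, div_one] at h2
  exact (ENNReal.ofReal_le_ofReal_iff hδ).mp h2

/-- Complete positivity enters the argument only here, through the case `k = 1`. -/
lemma IsCPTP.posSemidef {n : Type*} [Fintype n] {Φ : Matrix n n ℂ →ₗ[ℂ] Matrix n n ℂ}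
    (h : IsCPTP Φ) {X : Matrix n n ℂ} (hX : X.PosSemidef) : (Φ X).PosSemidef := by
  have := (h.completelyPositive 1 _ (hX.submatrix (Prod.snd : Fin 1 × n → n))).submatrix
    (fun a : n => ((0 : Fin 1), a))
  exact this

lemma IsCPTP.isDensity {n : Type*} [Fintype n] {Φ : Matrix n n ℂ →ₗ[ℂ] Matrix n n ℂ}
    (h : IsCPTP Φ) {ρ : Matrix n n ℂ} (hρ : IsDensity ρ) : IsDensity (Φ ρ) :=
  ⟨h.posSemidef hρ.1, (h.tracePreserving ρ).trans hρ.2⟩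

lemma IsCPTP.isDensity_pow {n : Type*} [Fintype n] {Φ : Matrix n n ℂ →ₗ[ℂ] Matrix n n ℂ}
    (h : IsCPTP Φ) {ρ : Matrix n n ℂ} (hρ : IsDensity ρ) (m : ℕ) :
    IsDensity ((Φ ^ m) ρ) := by
  induction m with
  | zero => simpa using hρ
  | succ m ih =>
    rw [pow_succ', Module.End.mul_apply]
    exact h.isDensity ih

/-! ### Random walks on the clock -/

section Walk

/-- One step of the simple random walk on `{0, …, T}` killed at both ends. -/
noncomputable def walkStep {T : ℕ} (f : Fin (T + 1) → ℝ) (t : Fin (T + 1)) : ℝ :=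
  1 / 2 * ∑ s : Fin T, (if s.succ = t then f s.castSucc else 0)
    + 1 / 2 * ∑ s : Fin T, (if s.castSucc = t then f s.succ else 0)

/-- Extension of a function on `{0, …, T}` by zero. -/
noncomputable def zeroExt {T : ℕ} (f : Fin (T + 1) → ℝ) (n : ℕ) : ℝ :=
  if h : n < T + 1 then f ⟨n, h⟩ else 0

lemma zeroExt_val {T : ℕ} (f : Fin (T + 1) → ℝ) (t : Fin (T + 1)) : zeroExt f t = f t := by
  rw [zeroExt, dif_pos t.is_lt]

lemma sum_ite_succ {T : ℕ} (f : Fin (T + 1) → ℝ) (t : Fin (T + 1)) :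
    ∑ s : Fin T, (if s.succ = t then f s.castSucc else 0)
      = if (t : ℕ) = 0 then 0 else zeroExt f (t - 1) := by
  refine Fin.cases ?_ (fun u => ?_) t
  · simp [Fin.succ_ne_zero]
  · simp only [Fin.succ_inj, Finset.sum_ite_eq', Finset.mem_univ, if_true]
    rw [← zeroExt_val f u.castSucc]
    simp

lemma sum_ite_castSucc {T : ℕ} (f : Fin (T + 1) → ℝ) (t : Fin (T + 1)) :
    ∑ s : Fin T, (if s.castSucc = t then f s.succ else 0) = zeroExt f (t + 1) := by
  refine Fin.lastCases ?_ (fun u => ?_) t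
  · simp [zeroExt, Fin.castSucc_ne_last]
  · simp only [Fin.castSucc_inj, Finset.sum_ite_eq', Finset.mem_univ, if_true]
    rw [← zeroExt_val f u.succ]
    simp

lemma walkStep_eq {T : ℕ} (f : Fin (T + 1) → ℝ) (t : Fin (T + 1)) :
    walkStep f t = 1 / 2 * (if (t : ℕ) = 0 then 0 else zeroExt f (t - 1))
      + 1 / 2 * zeroExt f (t + 1) := by
  rw [walkStep, sum_ite_succ, sum_ite_castSucc]

/-- The contraction rate of the clock walk. -/
noncomputable def walkRate (T : ℕ) : ℝ := 1 - 1 / (((T : ℝ) + 1) * (T + 2))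

lemma walkRate_nonneg (T : ℕ) : 0 ≤ walkRate T := by
  have : (1 : ℝ) ≤ ((T : ℝ) + 1) * (T + 2) := by
    have : (0 : ℝ) ≤ T := T.cast_nonneg
    nlinarith
  rw [walkRate, sub_nonneg]
  exact div_le_one_of_le₀ this (by linarith)

/-- A concave weight bounded by `(T + 1) (T + 2)` contracts at rate `walkRate T`. -/
lemma sub_one_le_walkRate_mul {T : ℕ} {w : ℝ} (hw : w ≤ ((T : ℝ) + 1) * (T + 2)) :
    w - 1 ≤ walkRate T * w := by
  have h : (0 : ℝ) < ((T : ℝ) + 1) * (T + 2) := by positivity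
  have : w / (((T : ℝ) + 1) * (T + 2)) ≤ 1 := div_le_one_of_le₀ hw h.le
  rw [walkRate, sub_mul, one_mul, one_div_mul_eq_div]
  linarith

lemma walkRate_pow_le (T m : ℕ) :
    walkRate T ^ m ≤ Real.exp (-(m / (((T : ℝ) + 1) * (T + 2)))) := by
  have h : walkRate T ≤ Real.exp (-(1 / (((T : ℝ) + 1) * (T + 2)))) := by
    have := Real.add_one_le_exp (-(1 / (((T : ℝ) + 1) * (T + 2))))
    rw [walkRate]
    linarith
  refine (pow_le_pow_left₀ (walkRate_nonneg T) h m).trans (le_of_eq ?_)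
  rw [← Real.exp_nat_mul]
  congr 1
  ring

/-- The walk killed at `0` and reflected at `T` decays geometrically. -/
lemma abs_killedWalk_le {T : ℕ} (d : ℕ → Fin (T + 1) → ℝ)
    (hstep : ∀ m t, d (m + 1) t = walkStep (d m) t
      + if t = Fin.last T then 1 / 2 * d m t else 0)
    (h0 : ∀ t, |d 0 t| ≤ 1) (m : ℕ) (t : Fin (T + 1)) :
    |d m t| ≤ walkRate T ^ m * (((t : ℝ) + 1) * (2 * T + 2 - t)) := by
  -- The weight `w t = (t + 1) * (2 * T + 2 - t)` has `(w (t - 1) + w (t + 1)) / 2 = w t - 1`. It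
  -- satisfies both boundary conditions: `w (-1) = 0` for killing at `0`, and `w (T + 1) = w T` for
  -- reflection at `T`.
  induction m generalizing t with
  | zero =>
    refine (h0 t).trans ?_
    have h1 : (t : ℝ) ≤ T := by exact_mod_cast t.is_le
    have h2 : (0 : ℝ) ≤ t := Nat.cast_nonneg _
    rw [pow_zero, one_mul]
    nlinarith
  | succ m ih =>
    have hR : 0 ≤ walkRate T ^ m := pow_nonneg (walkRate_nonneg T) m
    have htT : (t : ℝ) ≤ T := by exact_mod_cast t.is_le
    have ht0 : (0 : ℝ) ≤ t := Nat.cast_nonneg _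
    have hw : ((t : ℝ) + 1) * (2 * T + 2 - t) ≤ ((T : ℝ) + 1) * (T + 2) := by
      nlinarith [mul_nonneg (sub_nonneg.2 htT) (sub_nonneg.2 htT)]
    have hz : ∀ n : ℕ, n ≤ T → |zeroExt (d m) n|
        ≤ walkRate T ^ m * (((n : ℝ) + 1) * (2 * T + 2 - n)) := by
      intro n hn
      simpa [zeroExt, Nat.lt_succ_of_le hn] using ih ⟨n, Nat.lt_succ_of_le hn⟩
    have hleft : |if (t : ℕ) = 0 then 0 else zeroExt (d m) (t - 1)|
        ≤ walkRate T ^ m * ((t : ℝ) * (2 * T + 3 - t)) := by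
      split_ifs with h
      · simp [h]
      · have := hz (t - 1) (by omega)
        rw [Nat.cast_sub (Nat.one_le_iff_ne_zero.2 h)] at this
        refine this.trans (le_of_eq ?_)
        push_cast
        ring
    have hright : |zeroExt (d m) (t + 1) + if t = Fin.last T then d m t else 0|
        ≤ walkRate T ^ m * (((t : ℝ) + 2) * (2 * T + 1 - t)) := by
      split_ifs with h
      · have h' : zeroExt (d m) (t + 1) = 0 := by simp [zeroExt, h]
        rw [h', zero_add]
        refine (ih t).trans (mul_le_mul_of_nonneg_left (le_of_eq ?_) hR)
        rw [h, Fin.val_last]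
        ring
      · have h' : (t : ℕ) < T := Fin.lt_last_iff_ne_last.2 h
        have := hz (t + 1) h'
        rw [add_zero]
        refine this.trans (le_of_eq ?_)
        push_cast
        ring
    have heq : d (m + 1) t = 1 / 2 * (if (t : ℕ) = 0 then 0 else zeroExt (d m) (t - 1))
        + 1 / 2 * (zeroExt (d m) (t + 1) + if t = Fin.last T then d m t else 0) := by
      rw [hstep, walkStep_eq]
      split_ifs <;> ring
    have hfin := mul_le_mul_of_nonneg_left (sub_one_le_walkRate_mul hw) hR
    rw [abs_le] at hleft hright ⊢
    rw [heq, pow_succ]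
    constructor <;> nlinarith

/-- The difference of adjacent values of the walk reflected at both ends decays geometrically. -/
lemma abs_reflectedWalk_sub_le {T : ℕ} (p : ℕ → Fin (T + 1) → ℝ)
    (hstep : ∀ m t, p (m + 1) t = walkStep (p m) t
      + (if t = Fin.last T then 1 / 2 * p m t else 0) + (if t = 0 then 1 / 2 * p m t else 0))
    (h0 : ∀ t, p 0 t ∈ Set.Icc (0 : ℝ) 1) (m n : ℕ) (hn : n < T) :
    |zeroExt (p m) n - zeroExt (p m) (n + 1)|
      ≤ walkRate T ^ m * (((n : ℝ) + 1) * (T - n)) := by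
  -- Differences of adjacent values of a reflected walk form a walk killed just outside both ends.
  -- The weight `(n + 1) * (T - n)` vanishes at `n = -1` and `n = T`, and averaging its neighbours
  -- again lowers it by exactly `1`.
  induction m generalizing n with
  | zero =>
    have hz : ∀ k, zeroExt (p 0) k ∈ Set.Icc (0 : ℝ) 1 := by
      intro k
      rw [zeroExt]
      split_ifs
      · exact h0 _
      · simp
    have h1 : (n : ℝ) + 1 ≤ T := by exact_mod_cast hn
    have h2 : (0 : ℝ) ≤ n := Nat.cast_nonneg _
    have h3 : (1 : ℝ) ≤ ((n : ℝ) + 1) * (T - n) := by nlinarith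
    obtain ⟨ha, hb⟩ := hz n
    obtain ⟨hc, hd⟩ := hz (n + 1)
    rw [pow_zero, one_mul, abs_le]
    constructor <;> linarith
  | succ m ih =>
    have hR : 0 ≤ walkRate T ^ m := pow_nonneg (walkRate_nonneg T) m
    have h1 : (n : ℝ) + 1 ≤ T := by exact_mod_cast hn
    have h2 : (0 : ℝ) ≤ n := Nat.cast_nonneg _
    have hw : ((n : ℝ) + 1) * (T - n) ≤ ((T : ℝ) + 1) * (T + 2) := by nlinarith
    -- Truncated subtraction makes `k - 1 = 0` at `k = 0`, which encodes the reflection there.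
    have hz : ∀ k, k ≤ T → zeroExt (p (m + 1)) k
        = 1 / 2 * zeroExt (p m) (k - 1)
          + 1 / 2 * (if k = T then zeroExt (p m) k else zeroExt (p m) (k + 1)) := by
      intro k hk
      have hk' : k < T + 1 := Nat.lt_succ_of_le hk
      have e1 : zeroExt (p (m + 1)) k = p (m + 1) ⟨k, hk'⟩ := by simp [zeroExt, hk']
      have e2 : p m ⟨k, hk'⟩ = zeroExt (p m) k := by simp [zeroExt, hk']
      have e3 : ((⟨k, hk'⟩ : Fin (T + 1)) = Fin.last T) ↔ k = T := by simp [Fin.ext_iff]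
      have e4 : ((⟨k, hk'⟩ : Fin (T + 1)) = 0) ↔ k = 0 := by simp [Fin.ext_iff]
      rw [e1, hstep, walkStep_eq, e2]
      simp only [e3, e4]
      have e5 : k = T → zeroExt (p m) (k + 1) = 0 := by
        rintro rfl
        simp [zeroExt]
      by_cases ha : k = 0 <;> by_cases hb : k = T
      · rw [e5 hb]; simp [ha, ← hb]
      · simp [ha]
        split_ifs <;> first | omega | ring
      · rw [e5 hb]; simp [hb]
        split_ifs <;> first | omega | ring
      · simp only [ha, hb, if_false]
        ring
    have hleft : |zeroExt (p m) (n - 1) - zeroExt (p m) n|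
        ≤ walkRate T ^ m * ((n : ℝ) * (T + 1 - n)) := by
      rcases Nat.eq_zero_or_pos n with rfl | h
      · simp
      · obtain ⟨k, rfl⟩ : ∃ k, n = k + 1 := ⟨n - 1, by omega⟩
        have := ih k (by omega)
        rw [Nat.add_sub_cancel]
        refine this.trans (le_of_eq ?_)
        push_cast
        ring
    have hright : |zeroExt (p m) (n + 1)
          - if n + 1 = T then zeroExt (p m) (n + 1) else zeroExt (p m) (n + 1 + 1)|
        ≤ walkRate T ^ m * (((n : ℝ) + 2) * (T - 1 - n)) := by
      split_ifs with h
      · rw [sub_self, abs_zero, ← h]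
        simp
      · refine (ih (n + 1) (by omega)).trans (le_of_eq ?_)
        push_cast
        ring
    have heq : zeroExt (p (m + 1)) n - zeroExt (p (m + 1)) (n + 1)
        = 1 / 2 * (zeroExt (p m) (n - 1) - zeroExt (p m) n)
          + 1 / 2 * (zeroExt (p m) (n + 1)
          - if n + 1 = T then zeroExt (p m) (n + 1) else zeroExt (p m) (n + 1 + 1)) := by
      rw [hz n hn.le, hz (n + 1) hn, if_neg hn.ne, Nat.add_sub_cancel]
      ring
    have hfin := mul_le_mul_of_nonneg_left (sub_one_le_walkRate_mul hw) hR
    rw [abs_le] at hleft hright ⊢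
    rw [heq, pow_succ]
    constructor <;> nlinarith

/-- The walk reflected at both ends equidistributes. -/
lemma abs_reflectedWalk_last_sub_le {T : ℕ} (p : ℕ → Fin (T + 1) → ℝ)
    (hstep : ∀ m t, p (m + 1) t = walkStep (p m) t
      + (if t = Fin.last T then 1 / 2 * p m t else 0) + (if t = 0 then 1 / 2 * p m t else 0))
    (h0 : ∀ t, p 0 t ∈ Set.Icc (0 : ℝ) 1) (m : ℕ) (hsum : ∑ t, p m t = 1) :
    |p m (Fin.last T) - 1 / ((T : ℝ) + 1)| ≤ walkRate T ^ m * (T * ((T + 1) * (T + 2))) := by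
  set B : ℝ := walkRate T ^ m * ((T + 1) * (T + 2)) with hB
  have hR : 0 ≤ walkRate T ^ m := pow_nonneg (walkRate_nonneg T) m
  have hB0 : 0 ≤ B := by positivity
  have hadj : ∀ n, n < T → |zeroExt (p m) n - zeroExt (p m) (n + 1)| ≤ B := by
    intro n hn
    refine (abs_reflectedWalk_sub_le p hstep h0 m n hn).trans
      (mul_le_mul_of_nonneg_left ?_ hR)
    have h1 : (n : ℝ) + 1 ≤ T := by exact_mod_cast hn
    have h2 : (0 : ℝ) ≤ n := Nat.cast_nonneg _
    nlinarith
  have hfar : ∀ k, k ≤ T → |zeroExt (p m) T - zeroExt (p m) (T - k)| ≤ k * B := by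
    intro k
    induction k with
    | zero => simp
    | succ k ih =>
      intro hk
      have h1 := ih (by omega)
      have h2 := hadj (T - (k + 1)) (by omega)
      rw [show T - (k + 1) + 1 = T - k by omega] at h2
      rw [abs_le] at *
      push_cast
      constructor <;> linarith
  have hpt : ∀ t, |p m (Fin.last T) - p m t| ≤ T * B := by
    intro t
    have h := hfar (T - t) (by omega)
    rw [show T - (T - (t : ℕ)) = t by have := t.is_le; omega, zeroExt_val] at h
    have e : zeroExt (p m) T = p m (Fin.last T) := by
      rw [← zeroExt_val (p m) (Fin.last T), Fin.val_last]
    rw [e] at h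
    refine h.trans (mul_le_mul_of_nonneg_right ?_ hB0)
    exact_mod_cast Nat.sub_le _ _
  have hT : (0 : ℝ) < (T : ℝ) + 1 := by positivity
  -- As the total mass is `1`, the deviation at `T` is the average of the differences to all sites,
  -- each bounded by telescoping.
  have havg : p m (Fin.last T) - 1 / ((T : ℝ) + 1)
      = (∑ t, (p m (Fin.last T) - p m t)) / ((T : ℝ) + 1) := by
    rw [Finset.sum_sub_distrib, hsum]
    simp
    field_simp
  rw [havg, abs_div, abs_of_pos hT, div_le_iff₀ hT]
  refine (Finset.abs_sum_le_sum_abs _ _).trans ((Finset.sum_le_sum fun t _ => hpt t).trans ?_)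
  rw [Finset.sum_const, Finset.card_univ, Fintype.card_fin, nsmul_eq_mul, hB]
  push_cast
  apply le_of_eq
  ring

end Walk

/-! ### Dynamics of the diagonal clock blocks -/

section Blocks

open Matrix

variable {N T : ℕ}

/-- The block of a matrix on the full register between clock values `s` and `t`. -/
def clockBlock (ρ : Matrix (Reg N T) (Reg N T) ℂ) (s t : Fin (T + 1)) :
    Matrix (Bits N) (Bits N) ℂ :=
  ρ.submatrix (fun x => (x, s)) (fun x => (x, t))

lemma clockBlock_add (ρ σ : Matrix (Reg N T) (Reg N T) ℂ) (s t : Fin (T + 1)) :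
    clockBlock (ρ + σ) s t = clockBlock ρ s t + clockBlock σ s t := rfl

lemma clockBlock_smul {R : Type*} [SMul R ℂ] (c : R) (ρ : Matrix (Reg N T) (Reg N T) ℂ)
    (s t : Fin (T + 1)) : clockBlock (c • ρ) s t = c • clockBlock ρ s t := rfl

lemma clockBlock_sum {ι : Type*} (S : Finset ι) (f : ι → Matrix (Reg N T) (Reg N T) ℂ)
    (s t : Fin (T + 1)) : clockBlock (∑ i ∈ S, f i) s t = ∑ i ∈ S, clockBlock (f i) s t := by
  ext a b
  simp [clockBlock, Matrix.sum_apply]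

lemma clockBlock_kronecker_single_mul (A : Matrix (Bits N) (Bits N) ℂ)
    (i j s t : Fin (T + 1)) (ρ : Matrix (Reg N T) (Reg N T) ℂ) :
    clockBlock ((A ⊗ₖ Matrix.single i j (1 : ℂ)) * ρ) s t
      = if i = s then A * clockBlock ρ j t else 0 := by
  ext a b
  simp only [clockBlock, submatrix_apply, Matrix.mul_apply, Fintype.sum_prod_type,
    kroneckerMap_apply, Matrix.single_apply]
  split_ifs with h <;> simp [h, Matrix.mul_apply]

lemma clockBlock_mul_kronecker_single (A : Matrix (Bits N) (Bits N) ℂ)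
    (i j s t : Fin (T + 1)) (ρ : Matrix (Reg N T) (Reg N T) ℂ) :
    clockBlock (ρ * (A ⊗ₖ Matrix.single i j (1 : ℂ))) s t
      = if j = t then clockBlock ρ s i * A else 0 := by
  ext a b
  simp only [clockBlock, submatrix_apply, Matrix.mul_apply, Fintype.sum_prod_type,
    kroneckerMap_apply, Matrix.single_apply]
  split_ifs with h <;> simp [h, Matrix.mul_apply]

lemma conjTranspose_kronecker_single (A : Matrix (Bits N) (Bits N) ℂ) (i j : Fin (T + 1)) :
    (A ⊗ₖ Matrix.single i j (1 : ℂ))ᴴ = Aᴴ ⊗ₖ Matrix.single j i (1 : ℂ) := by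
  rw [conjTranspose_kronecker, conjTranspose_single, star_one]

lemma conjMap_smul (A ρ : Matrix (Reg N T) (Reg N T) ℂ) :
    conjMap (((1 / Real.sqrt 2 : ℝ) : ℂ) • A) ρ = (1 / 2 : ℝ) • (A * ρ * Aᴴ) := by
  have h : ((1 / Real.sqrt 2 : ℝ) : ℂ) * star ((1 / Real.sqrt 2 : ℝ) : ℂ) = ((1 / 2 : ℝ) : ℂ) := by
    rw [Complex.star_def, Complex.conj_ofReal, ← Complex.ofReal_mul, div_mul_div_comm, one_mul,
      Real.mul_self_sqrt (by norm_num)]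
  change (_ • A) * ρ * (_ • A)ᴴ = _
  rw [conjTranspose_smul, Matrix.smul_mul, Matrix.smul_mul, Matrix.mul_smul, smul_smul, h]
  ext a b
  simp

lemma clockBlock_conjMap_krausInit (a : Bits N) (ρ : Matrix (Reg N T) (Reg N T) ℂ)
    (t : Fin (T + 1)) :
    clockBlock (conjMap (krausInit N T a) ρ) t t
      = if t = 0 then Matrix.single (zeroBits N) (zeroBits N) ((1 / 2 : ℝ) * clockBlock ρ 0 0 a a)
        else 0 := by
  rw [krausInit, conjMap_smul, clockBlock_smul, conjTranspose_kronecker_single,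
    clockBlock_mul_kronecker_single, clockBlock_kronecker_single_mul]
  by_cases h : t = 0
  · subst h
    simp only [if_true, conjTranspose_single, star_one, single_mul_mul_single, one_mul, mul_one]
    rw [smul_single, Complex.real_smul]
  · simp [h, Ne.symm h]

lemma clockBlock_conjMap_krausFin (ρ : Matrix (Reg N T) (Reg N T) ℂ) (t : Fin (T + 1)) :
    clockBlock (conjMap (krausFin N T) ρ) t t
      = if t = Fin.last T then (1 / 2 : ℝ) • clockBlock ρ t t else 0 := by
  rw [krausFin, conjMap_smul, clockBlock_smul, conjTranspose_kronecker_single,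
    clockBlock_mul_kronecker_single, clockBlock_kronecker_single_mul]
  by_cases h : t = Fin.last T
  · simp [h]
  · simp [h, Ne.symm h]

/-- The cross terms of `K ρ Kᴴ` land in the blocks between `s` and `s + 1`, off the diagonal;
coherences of `ρ` therefore never feed the diagonal blocks. -/
lemma clockBlock_conjMap_krausProp (U : Circuit N T) (s : Fin T)
    (ρ : Matrix (Reg N T) (Reg N T) ℂ) (t : Fin (T + 1)) :
    clockBlock (conjMap (krausProp U s) ρ) t t
      = (1 / 2 : ℝ) • ((if s.succ = t then (U s : Matrix (Bits N) (Bits N) ℂ) *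
            clockBlock ρ s.castSucc s.castSucc * (U s : Matrix (Bits N) (Bits N) ℂ)ᴴ else 0)
          + if s.castSucc = t then (U s : Matrix (Bits N) (Bits N) ℂ)ᴴ *
            clockBlock ρ s.succ s.succ * (U s : Matrix (Bits N) (Bits N) ℂ) else 0) := by
  have hne : s.castSucc ≠ s.succ := (Fin.castSucc_lt_succ).ne
  rw [krausProp, conjMap_smul, clockBlock_smul, conjTranspose_add, conjTranspose_kronecker_single,
    conjTranspose_kronecker_single, Matrix.mul_add, clockBlock_add,
    clockBlock_mul_kronecker_single, clockBlock_mul_kronecker_single,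
    Matrix.add_mul, clockBlock_add, clockBlock_add]
  simp only [clockBlock_kronecker_single_mul, conjTranspose_conjTranspose]
  congr 1
  by_cases h : s.succ = t
  · subst h
    simp [hne]
  · by_cases h' : s.castSucc = t
    · subst h'
      simp [hne.symm]
    · simp [h, h']

/-- The value of the effect `E` on the clock-`t` block, after undoing the first `t` gates. -/
def blockObs (U : Circuit N T) (E : Matrix (Bits N) (Bits N) ℂ) (t : Fin (T + 1)) :
    Matrix (Reg N T) (Reg N T) ℂ →ₗ[ℝ] ℝ where
  toFun ρ := (E * ((partialCircuit U t)ᴴ * clockBlock ρ t t * partialCircuit U t)).trace.re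
  map_add' ρ σ := by
    simp [clockBlock_add, Matrix.mul_add, Matrix.add_mul]
  map_smul' c ρ := by
    simp [clockBlock_smul]

lemma blockObs_apply (U : Circuit N T) (E : Matrix (Bits N) (Bits N) ℂ) (t : Fin (T + 1))
    (ρ : Matrix (Reg N T) (Reg N T) ℂ) : blockObs U E t ρ
      = (E * ((partialCircuit U t)ᴴ * clockBlock ρ t t * partialCircuit U t)).trace.re := rfl

lemma blockObs_congr_clockBlock (U : Circuit N T) (E : Matrix (Bits N) (Bits N) ℂ)
    (t : Fin (T + 1)) {ρ : Matrix (Reg N T) (Reg N T) ℂ} {X : Matrix (Bits N) (Bits N) ℂ}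
    (h : clockBlock ρ t t = X) : blockObs U E t ρ
      = (E * ((partialCircuit U t)ᴴ * X * partialCircuit U t)).trace.re := by
  rw [blockObs_apply, h]

lemma partialCircuit_zero (U : Circuit N T) : partialCircuit U 0 = 1 := rfl

lemma partialCircuit_succ (U : Circuit N T) (s : Fin T) :
    partialCircuit U s.succ = (U s : Matrix (Bits N) (Bits N) ℂ) * partialCircuit U s.castSucc := by
  rw [partialCircuit, Fin.induction_succ]
  rfl

lemma partialCircuit_mem_unitaryGroup (U : Circuit N T) (t : Fin (T + 1)) :
    partialCircuit U t ∈ unitaryGroup (Bits N) ℂ := by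
  induction t using Fin.induction with
  | zero => exact one_mem _
  | succ s ih =>
    rw [partialCircuit_succ]
    exact mul_mem (U s).2 ih

lemma conjTranspose_mul_partialCircuit (U : Circuit N T) (t : Fin (T + 1)) :
    (partialCircuit U t)ᴴ * partialCircuit U t = 1 :=
  mem_unitaryGroup_iff'.1 (partialCircuit_mem_unitaryGroup U t)

lemma partialCircuit_mul_conjTranspose (U : Circuit N T) (t : Fin (T + 1)) :
    partialCircuit U t * (partialCircuit U t)ᴴ = 1 :=
  mem_unitaryGroup_iff.1 (partialCircuit_mem_unitaryGroup U t)

lemma blockObs_one (U : Circuit N T) (t : Fin (T + 1)) (ρ : Matrix (Reg N T) (Reg N T) ℂ) :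
    blockObs U 1 t ρ = (clockBlock ρ t t).trace.re := by
  rw [blockObs_apply, one_mul, trace_mul_comm, ← mul_assoc, partialCircuit_mul_conjTranspose,
    one_mul]

lemma sum_blockObs_one (U : Circuit N T) (ρ : Matrix (Reg N T) (Reg N T) ℂ) :
    ∑ t, blockObs U 1 t ρ = ρ.trace.re := by
  simp only [blockObs_one, Matrix.trace, Fintype.sum_prod_type_right, Complex.re_sum]
  rfl

/-- The reset produces the all-zeros state in block `0`, where no gate has to be undone, so the
previous content survives only through its total weight. -/
lemma blockObs_krausInit (U : Circuit N T) {E : Matrix (Bits N) (Bits N) ℂ} {e : ℝ}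
    (he : E (zeroBits N) (zeroBits N) = e) (t : Fin (T + 1))
    (ρ : Matrix (Reg N T) (Reg N T) ℂ) :
    ∑ a, blockObs U E t (conjMap (krausInit N T a) ρ)
      = if t = 0 then 1 / 2 * (e * blockObs U 1 0 ρ) else 0 := by
  simp only [blockObs_congr_clockBlock U E t (clockBlock_conjMap_krausInit _ ρ t)]
  split_ifs with h
  · subst h
    simp only [partialCircuit_zero, conjTranspose_one, one_mul, mul_one, blockObs_one,
      Matrix.trace_mul_single, he]
    simp [Matrix.trace, Finset.mul_sum, mul_left_comm]
  · simp

lemma blockObs_krausFin (U : Circuit N T) (E : Matrix (Bits N) (Bits N) ℂ) (t : Fin (T + 1))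
    (ρ : Matrix (Reg N T) (Reg N T) ℂ) :
    blockObs U E t (conjMap (krausFin N T) ρ)
      = if t = Fin.last T then 1 / 2 * blockObs U E t ρ else 0 := by
  rw [blockObs_congr_clockBlock U E t (clockBlock_conjMap_krausFin ρ t)]
  split_ifs with h
  · simp [blockObs_apply]
  · simp

/-- The gate applied by the propagation cancels against the one gate by which the two pull-backs
differ; what remains no longer sees the circuit. -/
lemma blockObs_krausProp (U : Circuit N T) (E : Matrix (Bits N) (Bits N) ℂ) (s : Fin T)
    (t : Fin (T + 1)) (ρ : Matrix (Reg N T) (Reg N T) ℂ) :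
    blockObs U E t (conjMap (krausProp U s) ρ)
      = 1 / 2 * (if s.succ = t then blockObs U E s.castSucc ρ else 0)
        + 1 / 2 * (if s.castSucc = t then blockObs U E s.succ ρ else 0) := by
  have hne : s.castSucc ≠ s.succ := (Fin.castSucc_lt_succ).ne
  have hU : (U s : Matrix (Bits N) (Bits N) ℂ)ᴴ * (U s : Matrix (Bits N) (Bits N) ℂ) = 1 :=
    mem_unitaryGroup_iff'.1 (U s).2
  have hU' : ∀ X : Matrix (Bits N) (Bits N) ℂ, (U s : Matrix (Bits N) (Bits N) ℂ)ᴴ *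
      ((U s : Matrix (Bits N) (Bits N) ℂ) * X) = X := by
    intro X
    rw [← mul_assoc, hU, one_mul]
  rw [blockObs_congr_clockBlock U E t (clockBlock_conjMap_krausProp U s ρ t)]
  by_cases h : s.succ = t
  · subst h
    simp [hne, blockObs_apply, partialCircuit_succ, mul_assoc, hU']
  · by_cases h' : s.castSucc = t
    · subst h'
      simp [hne.symm, blockObs_apply, partialCircuit_succ, mul_assoc]
    · simp [h, h']

/-- On the clock blocks, `𝓓` is a random walk that resets the computation at clock value `0`. -/
lemma blockObs_dqcMap (U : Circuit N T) {E : Matrix (Bits N) (Bits N) ℂ} {e : ℝ}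
    (he : E (zeroBits N) (zeroBits N) = e) (t : Fin (T + 1))
    (ρ : Matrix (Reg N T) (Reg N T) ℂ) :
    blockObs U E t (dqcMap U ρ)
      = walkStep (fun s => blockObs U E s ρ) t
        + (if t = Fin.last T then 1 / 2 * blockObs U E t ρ else 0)
        + (if t = 0 then 1 / 2 * (e * blockObs U 1 t ρ) else 0) := by
  rw [dqcMap, LinearMap.add_apply, LinearMap.add_apply, LinearMap.sum_apply, LinearMap.sum_apply,
    map_add, map_add, map_sum, map_sum, blockObs_krausInit U he, blockObs_krausFin]
  simp only [blockObs_krausProp]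
  rw [Finset.sum_add_distrib, ← Finset.mul_sum, ← Finset.mul_sum, walkStep]
  by_cases h : t = 0
  · subst h
    ring
  · rw [if_neg h, if_neg h]
    ring

lemma sum_walkStep (f : Fin (T + 1) → ℝ) :
    ∑ t, walkStep f t = ∑ t, f t - 1 / 2 * f (Fin.last T) - 1 / 2 * f 0 := by
  have h1 : ∑ t : Fin (T + 1), ∑ s : Fin T, (if s.succ = t then f s.castSucc else 0)
      = ∑ s : Fin T, f s.castSucc := by
    rw [Finset.sum_comm]
    simp
  have h2 : ∑ t : Fin (T + 1), ∑ s : Fin T, (if s.castSucc = t then f s.succ else 0)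
      = ∑ s : Fin T, f s.succ := by
    rw [Finset.sum_comm]
    simp
  simp only [walkStep]
  rw [Finset.sum_add_distrib, ← Finset.mul_sum, ← Finset.mul_sum, h1, h2]
  have h3 := Fin.sum_univ_castSucc f
  have h4 := Fin.sum_univ_succ f
  linarith

/-- The walk loses half of the mass at each end, and `krausFin` and `krausInit` return exactly these
halves. -/
lemma trace_re_dqcMap (U : Circuit N T) (ρ : Matrix (Reg N T) (Reg N T) ℂ) :
    (dqcMap U ρ).trace.re = ρ.trace.re := by
  have he : (1 : Matrix (Bits N) (Bits N) ℂ) (zeroBits N) (zeroBits N) = ((1 : ℝ) : ℂ) := by simp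
  rw [← sum_blockObs_one U, ← sum_blockObs_one U]
  simp only [blockObs_dqcMap U he]
  rw [Finset.sum_add_distrib, Finset.sum_add_distrib, sum_walkStep]
  simp
  ring

lemma posSemidef_dqcMap (U : Circuit N T) {ρ : Matrix (Reg N T) (Reg N T) ℂ}
    (hρ : ρ.PosSemidef) : (dqcMap U ρ).PosSemidef := by
  have h : ∀ K : Matrix (Reg N T) (Reg N T) ℂ, (conjMap K ρ).PosSemidef :=
    fun K => hρ.mul_mul_conjTranspose_same K
  rw [dqcMap, LinearMap.add_apply, LinearMap.add_apply, LinearMap.sum_apply, LinearMap.sum_apply]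
  exact ((posSemidef_sum _ fun _ _ => h _).add (h _)).add (posSemidef_sum _ fun _ _ => h _)

lemma posSemidef_dqcMap_pow (U : Circuit N T) {ρ : Matrix (Reg N T) (Reg N T) ℂ}
    (hρ : ρ.PosSemidef) (m : ℕ) : ((dqcMap U ^ m) ρ).PosSemidef := by
  induction m with
  | zero => simpa using hρ
  | succ m ih =>
    rw [pow_succ', Module.End.mul_apply]
    exact posSemidef_dqcMap U ih

lemma trace_re_dqcMap_pow (U : Circuit N T) (ρ : Matrix (Reg N T) (Reg N T) ℂ) (m : ℕ) :
    ((dqcMap U ^ m) ρ).trace.re = ρ.trace.re := by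
  induction m with
  | zero => simp
  | succ m ih => rw [pow_succ', Module.End.mul_apply, trace_re_dqcMap, ih]

open scoped MatrixOrder Matrix.Norms.L2Operator in
lemma blockObs_nonneg (U : Circuit N T) {E : Matrix (Bits N) (Bits N) ℂ} (hE : E.PosSemidef)
    (t : Fin (T + 1)) {ρ : Matrix (Reg N T) (Reg N T) ℂ} (hρ : ρ.PosSemidef) :
    0 ≤ blockObs U E t ρ := by
  obtain ⟨B, rfl⟩ : ∃ B : Matrix (Bits N) (Bits N) ℂ, E = Bᴴ * B :=
    CStarAlgebra.nonneg_iff_eq_star_mul_self.1 (nonneg_iff_posSemidef.2 hE)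
  -- With `E = Bᴴ * B`, cyclicity turns the observable into the trace of a congruence of a positive
  -- block.
  rw [blockObs_apply, mul_assoc, trace_mul_comm]
  exact (Complex.nonneg_iff.1 (((((hρ.submatrix _).conjTranspose_mul_mul_same
    (partialCircuit U t)).mul_mul_conjTranspose_same B)).trace_nonneg)).1

lemma blockObs_le (U : Circuit N T) {E : Matrix (Bits N) (Bits N) ℂ} (hE : (1 - E).PosSemidef)
    (t : Fin (T + 1)) {ρ : Matrix (Reg N T) (Reg N T) ℂ} (hρ : ρ.PosSemidef) :
    blockObs U E t ρ ≤ blockObs U 1 t ρ := by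
  have := blockObs_nonneg U hE t hρ
  rw [blockObs_apply, Matrix.sub_mul, trace_sub, Complex.sub_re, ← blockObs_apply,
    ← blockObs_apply] at this
  linarith

lemma blockObs_one_le_trace (U : Circuit N T) (t : Fin (T + 1))
    {ρ : Matrix (Reg N T) (Reg N T) ℂ} (hρ : ρ.PosSemidef) :
    blockObs U 1 t ρ ≤ ρ.trace.re := by
  rw [← sum_blockObs_one U]
  exact Finset.single_le_sum (fun s _ => blockObs_nonneg U PosSemidef.one s hρ) (Finset.mem_univ t)

/-- Convergence of `𝓓 ^ m` to its stationary state on the final clock block. -/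
lemma abs_blockObs_dqcMap_pow_sub_le (U : Circuit N T) {E : Matrix (Bits N) (Bits N) ℂ}
    (hE : E.PosSemidef) (hE' : (1 - E).PosSemidef) {e : ℝ}
    (he : E (zeroBits N) (zeroBits N) = e) (he0 : 0 ≤ e) (he1 : e ≤ 1)
    {ρ : Matrix (Reg N T) (Reg N T) ℂ} (hρ : IsDensity ρ) (m : ℕ) :
    |blockObs U E (Fin.last T) ((dqcMap U ^ m) ρ) - e / ((T : ℝ) + 1)|
      ≤ walkRate T ^ m * (((T : ℝ) + 1) * ((T + 1) * (T + 2))) := by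
  have hone : (1 : Matrix (Bits N) (Bits N) ℂ) (zeroBits N) (zeroBits N) = ((1 : ℝ) : ℂ) := by
    simp
  have htr : ρ.trace.re = 1 := by rw [hρ.2, Complex.one_re]
  set p : ℕ → Fin (T + 1) → ℝ := fun m t => blockObs U 1 t ((dqcMap U ^ m) ρ) with hp
  -- Subtracting `e * p` cancels the reset term at `0` and leaves a walk killed there.
  set d : ℕ → Fin (T + 1) → ℝ := fun m t => blockObs U E t ((dqcMap U ^ m) ρ) - e * p m t with hd
  have hp0 : ∀ t, p 0 t ∈ Set.Icc (0 : ℝ) 1 := by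
    intro t
    simp only [hp, pow_zero, Module.End.one_apply]
    exact ⟨blockObs_nonneg U PosSemidef.one t hρ.1, htr ▸ blockObs_one_le_trace U t hρ.1⟩
  have hpstep : ∀ m t, p (m + 1) t = walkStep (p m) t
      + (if t = Fin.last T then 1 / 2 * p m t else 0)
      + (if t = 0 then 1 / 2 * p m t else 0) := by
    intro m t
    simp only [hp]
    rw [pow_succ', Module.End.mul_apply, blockObs_dqcMap U hone, one_mul]
  have hdstep : ∀ m t, d (m + 1) t = walkStep (d m) t
      + if t = Fin.last T then 1 / 2 * d m t else 0 := by
    intro m t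
    have hlin : walkStep (d m) t = walkStep (fun s => blockObs U E s ((dqcMap U ^ m) ρ)) t
        - e * walkStep (p m) t := by
      simp only [walkStep_eq, zeroExt, hd]
      split_ifs <;> ring
    rw [hlin]
    simp only [hd]
    rw [hpstep, pow_succ', Module.End.mul_apply, blockObs_dqcMap U he]
    simp only [hp]
    split_ifs <;> ring
  have hd0 : ∀ t, |d 0 t| ≤ 1 := by
    intro t
    obtain ⟨h1, h2⟩ := hp0 t
    have h3 := blockObs_nonneg U hE t hρ.1
    have h4 := blockObs_le U hE' t hρ.1
    have h5 : p 0 t = blockObs U 1 t ρ := by simp [hp]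
    have h6 : d 0 t = blockObs U E t ρ - e * p 0 t := by simp [hd]
    rw [← h5] at h4
    rw [h6, abs_le]
    constructor <;> nlinarith
  have hsum : ∑ t, p m t = 1 := by
    simp only [hp]
    rw [sum_blockObs_one, trace_re_dqcMap_pow, htr]
  have h1 := abs_killedWalk_le d hdstep hd0 m (Fin.last T)
  have h2 := abs_reflectedWalk_last_sub_le p hpstep hp0 m hsum
  have h3 : blockObs U E (Fin.last T) ((dqcMap U ^ m) ρ) - e / ((T : ℝ) + 1)
      = d m (Fin.last T) + e * (p m (Fin.last T) - 1 / ((T : ℝ) + 1)) := by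
    simp only [hd]
    ring
  have h4 : |e * (p m (Fin.last T) - 1 / ((T : ℝ) + 1))|
      ≤ walkRate T ^ m * (T * ((T + 1) * (T + 2))) := by
    rw [abs_mul, abs_of_nonneg he0]
    exact (mul_le_of_le_one_left (abs_nonneg _) he1).trans h2
  rw [h3]
  refine (abs_add_le _ _).trans ((add_le_add h1 h4).trans (le_of_eq ?_))
  rw [Fin.val_last]
  ring

end Blocks

/-! ### Stability under noise -/

section Robustness

open Matrix

variable {N T : ℕ}

/-- Perturbing each of `m` steps by `δ` changes the final observables by at most `m δ`. -/
lemma abs_blockObs_pow_sub_le (U : Circuit N T) {E : Matrix (Bits N) (Bits N) ℂ}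
    (hE : E.PosSemidef) (hE' : (1 - E).PosSemidef) (t : Fin (T + 1))
    {Dt : Matrix (Reg N T) (Reg N T) ℂ →ₗ[ℂ] Matrix (Reg N T) (Reg N T) ℂ} (hD : IsCPTP Dt)
    {δ : ℝ} (hδ : 0 ≤ δ) (hn : norm1to1 (dqcMap U - Dt) ≤ ENNReal.ofReal δ)
    {ρ : Matrix (Reg N T) (Reg N T) ℂ} (hρ : IsDensity ρ) (m k : ℕ) :
    |blockObs U E t ((dqcMap U ^ k) ((Dt ^ m) ρ)) - blockObs U E t ((dqcMap U ^ (k + m)) ρ)|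
      ≤ m * δ := by
  -- Hybrid argument: `k` counts the noiseless steps applied after the noisy ones. The induction
  -- step replaces the last noisy step by a noiseless one, so `k` must vary.
  induction m generalizing k with
  | zero => simp
  | succ m ih =>
    have hτ := hD.isDensity_pow hρ m
    set τ := (Dt ^ m) ρ with hτd
    have hH : ((dqcMap U - Dt) τ).IsHermitian :=
      (posSemidef_dqcMap U hτ.1).isHermitian.sub (hD.posSemidef hτ.1).isHermitian
    obtain ⟨F, hF⟩ : ∃ F : Matrix (Reg N T) (Reg N T) ℂ →ₗ[ℝ] ℝ,
        ∀ X, F X = blockObs U E t ((dqcMap U ^ k) X) :=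
      ⟨blockObs U E t ∘ₗ (dqcMap U ^ k).restrictScalars ℝ, fun _ => rfl⟩
    -- The observable after `k` noiseless steps is still positive and dominated by the trace, so the
    -- one-step error is not amplified.
    have h1 := abs_le_traceNorm_of_isHermitian hH F
      (fun X hX => by
        rw [hF]
        exact blockObs_nonneg U hE t (posSemidef_dqcMap_pow U hX k))
      (fun X hX => by
        rw [hF, ← trace_re_dqcMap_pow U X k]
        exact (blockObs_le U hE' t (posSemidef_dqcMap_pow U hX k)).trans
          (blockObs_one_le_trace U t (posSemidef_dqcMap_pow U hX k)))
    have h2 := h1.trans (traceNorm_apply_le hδ hn hτ)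
    have h3 := ih (k + 1)
    have e1 : (dqcMap U ^ (k + 1)) τ = (dqcMap U ^ k) (dqcMap U τ) := by
      rw [pow_succ, Module.End.mul_apply]
    have e2 : (Dt ^ (m + 1)) ρ = Dt τ := by
      rw [pow_succ', Module.End.mul_apply]
    rw [hF, LinearMap.sub_apply, map_sub, map_sub] at h2
    rw [e1, show k + 1 + m = k + (m + 1) by ring] at h3
    rw [e2]
    rw [abs_le] at *
    push_cast
    constructor <;> linarith

/-! ### Clock and error probabilities as block observables -/

lemma trace_eq_sum_clockBlock (ρ : Matrix (Reg N T) (Reg N T) ℂ) :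
    ρ.trace = ∑ t, (clockBlock ρ t t).trace := by
  simp only [Matrix.trace, Fintype.sum_prod_type_right]
  rfl

lemma clockBlock_clockProj_mul (ρ : Matrix (Reg N T) (Reg N T) ℂ) (t : Fin (T + 1)) :
    clockBlock (clockProj N T * ρ) t t
      = if Fin.last T = t then clockBlock ρ (Fin.last T) (Fin.last T) else 0 := by
  rw [clockProj, clockBlock_kronecker_single_mul, one_mul]
  split_ifs with h
  · rw [h]
  · rfl

lemma trace_clockProj_mul (ρ : Matrix (Reg N T) (Reg N T) ℂ) :
    (clockProj N T * ρ).trace = (clockBlock ρ (Fin.last T) (Fin.last T)).trace := by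
  rw [trace_eq_sum_clockBlock]
  simp only [clockBlock_clockProj_mul]
  rw [Finset.sum_eq_single (Fin.last T) (fun t _ h => by rw [if_neg h.symm, trace_zero])
    (by simp), if_pos rfl]

lemma clockBlock_kronecker_one_mul (A : Matrix (Bits N) (Bits N) ℂ)
    (ρ : Matrix (Reg N T) (Reg N T) ℂ) (s t : Fin (T + 1)) :
    clockBlock ((A ⊗ₖ (1 : Matrix (Fin (T + 1)) (Fin (T + 1)) ℂ)) * ρ) s t
      = A * clockBlock ρ s t := by
  ext a b
  simp [clockBlock, Matrix.mul_apply, Fintype.sum_prod_type, Matrix.one_apply]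

/-- The projector onto the outcome `v` of qubit `j`, without the clock register. -/
def bitProj (j : Fin N) (v : Bool) : Matrix (Bits N) (Bits N) ℂ :=
  Matrix.diagonal fun x : Bits N => if x j = v then (1 : ℂ) else 0

lemma trace_outcomeProj_mul (j : Fin N) (v : Bool) (ρ : Matrix (Reg N T) (Reg N T) ℂ) :
    (outcomeProj T j v * (clockProj N T * ρ)).trace
      = (bitProj j v * clockBlock ρ (Fin.last T) (Fin.last T)).trace := by
  rw [trace_eq_sum_clockBlock]
  simp only [outcomeProj, clockBlock_kronecker_one_mul, clockBlock_clockProj_mul]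
  rw [Finset.sum_eq_single (Fin.last T) (fun t _ h => by
    rw [if_neg h.symm, Matrix.mul_zero, trace_zero]) (by simp), if_pos rfl, bitProj]

/-- The effect of the outcome `v` of qubit `j`, pulled back through the whole circuit. -/
def outputEffect (U : Circuit N T) (j : Fin N) (v : Bool) : Matrix (Bits N) (Bits N) ℂ :=
  (partialCircuit U (Fin.last T))ᴴ * bitProj j v * partialCircuit U (Fin.last T)

lemma posSemidef_outputEffect (U : Circuit N T) (j : Fin N) (v : Bool) :
    (outputEffect U j v).PosSemidef := by
  refine PosSemidef.conjTranspose_mul_mul_same (posSemidef_diagonal_iff.2 fun x => ?_) _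
  split_ifs <;> simp

lemma posSemidef_one_sub_outputEffect (U : Circuit N T) (j : Fin N) (v : Bool) :
    (1 - outputEffect U j v).PosSemidef := by
  have h : 1 - outputEffect U j v = (partialCircuit U (Fin.last T))ᴴ * (1 - bitProj j v)
      * partialCircuit U (Fin.last T) := by
    rw [Matrix.mul_sub, Matrix.sub_mul, mul_one, conjTranspose_mul_partialCircuit, outputEffect]
  rw [h]
  refine PosSemidef.conjTranspose_mul_mul_same ?_ _
  rw [bitProj, ← diagonal_one, diagonal_sub]
  refine posSemidef_diagonal_iff.2 fun x => ?_
  split_ifs <;> simp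

lemma clockProb_eq (U : Circuit N T) (ρ : Matrix (Reg N T) (Reg N T) ℂ) :
    clockProb ρ = blockObs U 1 (Fin.last T) ρ := by
  rw [clockProb, trace_clockProj_mul, blockObs_one]

lemma blockObs_outputEffect (U : Circuit N T) (j : Fin N) (v : Bool)
    (ρ : Matrix (Reg N T) (Reg N T) ℂ) :
    blockObs U (outputEffect U j v) (Fin.last T) ρ
      = (outcomeProj T j v * (clockProj N T * ρ)).trace.re := by
  rw [trace_outcomeProj_mul, blockObs_apply, outputEffect]
  congr 1
  set V := partialCircuit U (Fin.last T)
  have hV : V * Vᴴ = 1 := partialCircuit_mul_conjTranspose U (Fin.last T)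
  rw [show Vᴴ * bitProj j v * V * (Vᴴ * clockBlock ρ (Fin.last T) (Fin.last T) * V)
      = Vᴴ * (bitProj j v * (V * Vᴴ) * clockBlock ρ (Fin.last T) (Fin.last T)) * V by
    simp only [mul_assoc], hV, mul_one, trace_mul_comm, ← mul_assoc, hV, one_mul]

lemma errorProb_eq (U : Circuit N T) (j : Fin N) (b : Bool)
    {ρ : Matrix (Reg N T) (Reg N T) ℂ} {r : ℝ} (h : (clockProj N T * ρ).trace = r) :
    errorProb j b ρ = blockObs U (outputEffect U j (!b)) (Fin.last T) ρ / r := by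
  rw [errorProb, Matrix.mul_smul, trace_smul, h, blockObs_outputEffect, smul_eq_mul,
    ← Complex.ofReal_inv, Complex.re_ofReal_mul, div_eq_inv_mul]

/-- Positivity makes the complex normalisation real, so the conditional probability is a real
quotient. -/
lemma errorProb_eq_of_posSemidef (U : Circuit N T) (j : Fin N) (b : Bool)
    {ρ : Matrix (Reg N T) (Reg N T) ℂ} (hρ : ρ.PosSemidef) :
    errorProb j b ρ = blockObs U (outputEffect U j (!b)) (Fin.last T) ρ
      / blockObs U 1 (Fin.last T) ρ := by
  refine errorProb_eq U j b ?_
  have h0 : 0 ≤ (clockBlock ρ (Fin.last T) (Fin.last T)).trace := (hρ.submatrix _).trace_nonneg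
  rw [trace_clockProj_mul, blockObs_one]
  exact Complex.ext rfl (Complex.nonneg_iff.1 h0).2.symm

lemma vecMulVec_psi (U : Circuit N T) (t : Fin (T + 1)) :
    Matrix.vecMulVec (psi U t) (star (psi U t)) = partialCircuit U t *
      Matrix.single (zeroBits N) (zeroBits N) 1 * (partialCircuit U t)ᴴ := by
  have h : Matrix.single (zeroBits N) (zeroBits N) (1 : ℂ)
      = Matrix.vecMulVec (Pi.single (zeroBits N) 1) (star (Pi.single (zeroBits N) 1)) := by
    rw [← Pi.single_star, star_one, Matrix.single_eq_single_vecMulVec_single]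
  rw [h, mul_vecMulVec, vecMulVec_mul, psi, star_mulVec]

lemma clockBlock_rhoInfty (U : Circuit N T) (t : Fin (T + 1)) :
    clockBlock (rhoInfty U) t t = ((T : ℂ) + 1)⁻¹ • (partialCircuit U t *
      Matrix.single (zeroBits N) (zeroBits N) 1 * (partialCircuit U t)ᴴ) := by
  rw [rhoInfty, clockBlock_smul, clockBlock_sum, ← vecMulVec_psi]
  congr 1
  ext a b
  simp [clockBlock, Matrix.sum_apply, Matrix.single_apply]

lemma blockObs_rhoInfty (U : Circuit N T) {E : Matrix (Bits N) (Bits N) ℂ} {e : ℝ}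
    (he : E (zeroBits N) (zeroBits N) = e) (t : Fin (T + 1)) :
    blockObs U E t (rhoInfty U) = e / ((T : ℝ) + 1) := by
  rw [blockObs_apply, clockBlock_rhoInfty]
  set V := partialCircuit U t
  have hV : Vᴴ * V = 1 := conjTranspose_mul_partialCircuit U t
  rw [Matrix.mul_smul, Matrix.smul_mul, show Vᴴ * (V * Matrix.single (zeroBits N) (zeroBits N) 1
      * Vᴴ) * V = (Vᴴ * V) * Matrix.single (zeroBits N) (zeroBits N) 1 * (Vᴴ * V) by
    simp only [mul_assoc], hV, one_mul, mul_one, Matrix.mul_smul, trace_smul, trace_mul_single, he]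
  have : ((T : ℂ) + 1)⁻¹ = ((((T : ℝ) + 1)⁻¹ : ℝ) : ℂ) := by push_cast; rfl
  rw [this, smul_eq_mul, Complex.re_ofReal_mul]
  simp [div_eq_inv_mul]

/-- Turns the bounded-error hypothesis into a bound on `e`, the only feature of the circuit that the
walk retains. -/
lemma errorProb_rhoInfty (U : Circuit N T) (j : Fin N) (b : Bool) {e : ℝ}
    (he : outputEffect U j (!b) (zeroBits N) (zeroBits N) = e) :
    errorProb j b (rhoInfty U) = e := by
  have h : (clockProj N T * rhoInfty U).trace = ((1 / ((T : ℝ) + 1) : ℝ) : ℂ) := by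
    rw [trace_clockProj_mul, clockBlock_rhoInfty, trace_smul, trace_mul_comm, ← mul_assoc,
      conjTranspose_mul_partialCircuit, one_mul, trace_single_eq_same]
    push_cast
    rw [smul_eq_mul, mul_one, one_div]
  have hT : (0 : ℝ) < (T : ℝ) + 1 := by positivity
  rw [errorProb_eq U j b h, blockObs_rhoInfty U he]
  field_simp

lemma exists_outputEffect_apply (U : Circuit N T) (j : Fin N) (v : Bool) :
    ∃ e : ℝ, outputEffect U j v (zeroBits N) (zeroBits N) = e ∧ 0 ≤ e ∧ e ≤ 1 := by
  have h0 := Complex.nonneg_iff.1 ((posSemidef_outputEffect U j v).diag_nonneg (i := zeroBits N))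
  have h1 := Complex.nonneg_iff.1
    ((posSemidef_one_sub_outputEffect U j v).diag_nonneg (i := zeroBits N))
  rw [Matrix.sub_apply, Matrix.one_apply_eq, Complex.sub_re, Complex.one_re] at h1
  exact ⟨_, Complex.ext rfl h0.2.symm, h0.1, by linarith [h1.1]⟩

/-! ### Quantitative estimates -/

lemma half_le_log {T : ℕ} (hT : 2 ≤ T) : 1 / 2 ≤ Real.log T := by
  have h : Real.log 2 ≤ Real.log T := Real.log_le_log (by norm_num) (by exact_mod_cast hT)
  linarith [Real.log_two_gt_d9]

/-- After `O(T² log T)` steps the walk is polynomially close to equilibrium. -/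
lemma walkRate_pow_mul_le {T : ℕ} (hT : 2 ≤ T) {κ : ℝ} (hκ : 0 < κ) (hκ1 : κ ≤ 1) {m : ℕ}
    (hm : 3 * (4 + 2 * Real.log (16 / κ)) * ((T : ℝ) ^ 2 * Real.log T) ≤ m) :
    walkRate T ^ m * (((T : ℝ) + 1) * ((T + 1) * (T + 2))) ≤ κ / 2 / ((T : ℝ) + 1) := by
  have hT' : (2 : ℝ) ≤ T := by exact_mod_cast hT
  have hlog := half_le_log hT
  set s := 2 * Real.log (16 / κ) with hs
  have hs0 : 0 ≤ s := mul_nonneg (by norm_num)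
    (Real.log_nonneg (by rw [le_div_iff₀ hκ]; linarith))
  have h1 : (4 + s) * Real.log T ≤ m / (((T : ℝ) + 1) * (T + 2)) := by
    rw [le_div_iff₀ (by positivity)]
    refine le_trans ?_ hm
    have h2 : ((T : ℝ) + 1) * (T + 2) ≤ 3 * T ^ 2 := by nlinarith
    have h3 : 0 ≤ (4 + s) * Real.log T := by positivity
    nlinarith [mul_le_mul_of_nonneg_left h2 h3]
  -- By `1 / 2 ≤ log T`. In the exponent, `s / 2 = log (16 / κ)` yields the factor `κ / 16`, and `4
  -- * log T` yields `T ^ (-4)` against the quartic prefactor.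
  have h2 : s / 2 + 4 * Real.log T ≤ (4 + s) * Real.log T := by nlinarith
  have h3 : walkRate T ^ m ≤ κ / 16 * ((T : ℝ) ^ 4)⁻¹ := by
    refine (walkRate_pow_le T m).trans ?_
    refine (Real.exp_le_exp.2 (neg_le_neg (h2.trans h1))).trans (le_of_eq ?_)
    rw [neg_add, Real.exp_add, hs, mul_div_cancel_left₀ _ (by norm_num), ← Real.log_inv,
      Real.exp_log (by positivity), inv_div, Real.exp_neg]
    congr 2
    rw [show (4 : ℝ) * Real.log T = ((4 : ℕ) : ℝ) * Real.log T by norm_num, Real.exp_nat_mul,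
      Real.exp_log (by linarith)]
  have h4 : ((T : ℝ) + 1) * (((T : ℝ) + 1) * ((T + 1) * (T + 2))) ≤ 8 * T ^ 4 := by
    have ha : (T : ℝ) + 1 ≤ 3 / 2 * T := by linarith
    have hb : (T : ℝ) + 2 ≤ 2 * T := by linarith
    calc ((T : ℝ) + 1) * (((T : ℝ) + 1) * ((T + 1) * (T + 2)))
        ≤ (3 / 2 * T) * ((3 / 2 * T) * ((3 / 2 * T) * (2 * T))) := by gcongr
      _ ≤ 8 * (T : ℝ) ^ 4 := by nlinarith [pow_pos (by linarith : (0 : ℝ) < T) 4]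
  have hT4 : (0 : ℝ) < (T : ℝ) ^ 4 := by positivity
  rw [le_div_iff₀ (by positivity)]
  calc walkRate T ^ m * (((T : ℝ) + 1) * ((T + 1) * (T + 2))) * (T + 1)
      = walkRate T ^ m * (((T : ℝ) + 1) * (((T : ℝ) + 1) * ((T + 1) * (T + 2)))) := by ring
    _ ≤ κ / 16 * ((T : ℝ) ^ 4)⁻¹ * (8 * T ^ 4) := by gcongr
    _ = κ / 2 := by field_simp; norm_num

/-- Conditional probabilities are stable under small relative perturbations. -/
lemma div_le_add_of_abs_sub_le {a p e x η κ : ℝ} (hx : 0 < x) (hη : 0 < η)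
    (hκ : κ = η / (2 + η)) (he : e ≤ 1 / 3) (ha : |a - e / x| ≤ κ / x)
    (hp : |p - 1 / x| ≤ κ / x) : 0 < p ∧ a / p ≤ 1 / 3 + η := by
  have hκ1 : κ * (2 + η) = η := by rw [hκ]; field_simp
  have hκ0 : 0 < κ := by rw [hκ]; positivity
  have hκ2 : κ < 1 := by rw [hκ, div_lt_one (by positivity)]; linarith
  have ha' := (abs_le.1 ha).2
  have hp' := (abs_le.1 hp).1
  have h1 : (1 - κ) / x ≤ p := by rw [sub_div]; linarith
  have h2 : a ≤ (1 / 3 + κ) / x := by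
    have : e / x ≤ 1 / 3 / x := by gcongr
    rw [add_div]
    linarith
  have hp0 : 0 < p := lt_of_lt_of_le (div_pos (by linarith) hx) h1
  refine ⟨hp0, (div_le_iff₀ hp0).2 (h2.trans ?_)⟩
  refine le_trans ?_ (mul_le_mul_of_nonneg_left h1 (by positivity))
  rw [← mul_div_assoc]
  gcongr
  -- The claim `1 / 3 + κ ≤ (1 / 3 + η) * (1 - κ)` amounts to `κ * (4 / 3 + η) ≤ η`, and `κ * (2 +
  -- η) = η`.
  nlinarith

end Robustness

end DQC

/-! ### Assembly of the main theorem -/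

theorem mainTheorem3 :
    ∀ η : ℝ, 0 < η →
      ∃ c K : ℝ, 0 < c ∧ 0 < K ∧
        ∀ (N T : ℕ), 2 ≤ T →
        ∀ (U : DQC.Circuit N T) (j : Fin N) (b : Bool),
          DQC.errorProb j b (DQC.rhoInfty U) ≤ 1 / 3 →
        ∀ (Dt : Matrix (DQC.Reg N T) (DQC.Reg N T) ℂ →ₗ[ℂ]
              Matrix (DQC.Reg N T) (DQC.Reg N T) ℂ) (δ : ℝ),
          DQC.IsCPTP Dt →
          DQC.norm1to1 (DQC.dqcMap U - Dt) ≤ ENNReal.ofReal δ →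
          δ ≤ c / ((N : ℝ) * (T : ℝ) ^ 3 * Real.log T) →
          (∀ ρ : Matrix (DQC.Reg N T) (DQC.Reg N T) ℂ, DQC.IsDensity ρ →
            ∀ m : ℕ, K * (N : ℝ) * (T : ℝ) ^ 2 * Real.log T ≤ (m : ℝ) →
              0 < DQC.clockProb ((Dt ^ m) ρ) ∧
              DQC.errorProb j b ((Dt ^ m) ρ) ≤ 1 / 3 + η) ∧
          (∀ ρ : Matrix (DQC.Reg N T) (DQC.Reg N T) ℂ, DQC.IsDensity ρ → Dt ρ = ρ →
              0 < DQC.clockProb ρ ∧ DQC.errorProb j b ρ ≤ 1 / 3 + η) := by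
  intro η hη
  obtain ⟨κ, hκ⟩ : ∃ κ : ℝ, κ = η / (2 + η) := ⟨_, rfl⟩
  have hκ0 : 0 < κ := by rw [hκ]; positivity
  have hκ1 : κ ≤ 1 := by rw [hκ]; exact div_le_one_of_le₀ (by linarith) (by linarith)
  obtain ⟨K₀, hK₀⟩ : ∃ K₀ : ℝ, K₀ = 3 * (4 + 2 * Real.log (16 / κ)) := ⟨_, rfl⟩
  have hK₀0 : 0 < K₀ := by
    have : 0 ≤ Real.log (16 / κ) := Real.log_nonneg (by rw [le_div_iff₀ hκ0]; linarith)
    rw [hK₀]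
    positivity
  -- `K₀` is the mixing constant and the extra `1` absorbs rounding up to an integer. The first
  -- constant makes the noise accumulated over the mixing time at most `κ / (4 * T)`.
  refine ⟨κ / (4 * (K₀ + 1)), K₀ + 1, by positivity, by positivity, ?_⟩
  intro N T hT U j b herr Dt δ hD hn hδ
  have hN : (1 : ℝ) ≤ N := by exact_mod_cast Nat.one_le_iff_ne_zero.2 (by rintro rfl; exact j.elim0)
  have hT' : (2 : ℝ) ≤ T := by exact_mod_cast hT
  have hlog := DQC.half_le_log hT
  obtain ⟨e, he, he0, he1⟩ := DQC.exists_outputEffect_apply U j (!b)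
  rw [DQC.errorProb_rhoInfty U j b he] at herr
  obtain ⟨L, hL⟩ : ∃ L : ℝ, L = (T : ℝ) ^ 2 * Real.log T := ⟨_, rfl⟩
  have hL1 : 1 ≤ L := by rw [hL]; nlinarith
  -- A negative `δ` is possible; `ENNReal.ofReal` then reads it as `0`.
  obtain ⟨δ', hδ'⟩ : ∃ δ' : ℝ, δ' = max δ 0 := ⟨_, rfl⟩
  have hδ0 : 0 ≤ δ' := hδ' ▸ le_max_right _ _
  have hn' : DQC.norm1to1 (DQC.dqcMap U - Dt) ≤ ENNReal.ofReal δ' :=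
    hn.trans (ENNReal.ofReal_le_ofReal (hδ' ▸ le_max_left _ _))
  have hδL : δ' ≤ κ / (4 * (K₀ + 1)) / (T * L) := by
    rw [hδ']
    refine max_le (hδ.trans ?_) (by positivity)
    refine div_le_div_of_nonneg_left (by positivity) (by positivity) ?_
    rw [hL]
    have h0 : 0 ≤ (T : ℝ) ^ 3 * Real.log T := by positivity
    nlinarith [mul_le_mul_of_nonneg_right hN h0]
  have key : ∀ ρ : Matrix (DQC.Reg N T) (DQC.Reg N T) ℂ, DQC.IsDensity ρ →
      ∀ m : ℕ, (K₀ + 1) * (N : ℝ) * (T : ℝ) ^ 2 * Real.log T ≤ (m : ℝ) →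
        0 < DQC.clockProb ((Dt ^ m) ρ) ∧ DQC.errorProb j b ((Dt ^ m) ρ) ≤ 1 / 3 + η := by
    intro ρ hρ m hm
    -- Only the last `m₀` steps are compared with the noiseless dynamics, so the accumulated error
    -- does not grow with `m`.
    obtain ⟨m₀, hm₀⟩ : ∃ m₀ : ℕ, m₀ = ⌈K₀ * L⌉₊ := ⟨_, rfl⟩
    have hm₀l : K₀ * L ≤ m₀ := hm₀ ▸ Nat.le_ceil _
    have hm₀u : (m₀ : ℝ) ≤ (K₀ + 1) * L := by
      have := (Nat.ceil_lt_add_one (by positivity : 0 ≤ K₀ * L)).le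
      rw [← hm₀] at this
      linarith
    have hmm : m₀ ≤ m := by
      have h0 : 0 ≤ (K₀ + 1) * L := by positivity
      have h1 : (K₀ + 1) * L ≤ m := by
        refine le_trans ?_ hm
        rw [show (K₀ + 1) * (N : ℝ) * (T : ℝ) ^ 2 * Real.log T = N * ((K₀ + 1) * L) by
          rw [hL]; ring]
        exact le_mul_of_one_le_left h0 hN
      exact_mod_cast hm₀u.trans h1
    have hσ := hD.isDensity_pow hρ (m - m₀)
    have hsplit : (Dt ^ m) ρ = (Dt ^ m₀) ((Dt ^ (m - m₀)) ρ) := by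
      rw [← Module.End.mul_apply, ← pow_add, Nat.add_sub_cancel' hmm]
    obtain ⟨σ, hσd⟩ : ∃ σ, σ = (Dt ^ (m - m₀)) ρ := ⟨_, rfl⟩
    rw [hsplit, ← hσd]
    rw [← hσd] at hσ
    have hx : (0 : ℝ) < (T : ℝ) + 1 := by positivity
    have hnoise : m₀ * δ' ≤ κ / 2 / ((T : ℝ) + 1) := by
      calc m₀ * δ' ≤ ((K₀ + 1) * L) * (κ / (4 * (K₀ + 1)) / (T * L)) := by gcongr
        _ = κ / (4 * T) := by field_simp
        _ ≤ κ / (2 * ((T : ℝ) + 1)) :=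
          div_le_div_of_nonneg_left hκ0.le (by positivity) (by linarith)
        _ = κ / 2 / ((T : ℝ) + 1) := by rw [div_div]
    have hmix := DQC.walkRate_pow_mul_le hT hκ0 hκ1 (m := m₀) (by rw [← hK₀, ← hL]; exact hm₀l)
    have hclose : ∀ (E : Matrix (DQC.Bits N) (DQC.Bits N) ℂ) (f : ℝ), E.PosSemidef →
        (1 - E).PosSemidef → E (DQC.zeroBits N) (DQC.zeroBits N) = f → 0 ≤ f → f ≤ 1 →
        |DQC.blockObs U E (Fin.last T) ((Dt ^ m₀) σ) - f / ((T : ℝ) + 1)|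
          ≤ κ / ((T : ℝ) + 1) := by
      intro E f hE hE' hf hf0 hf1
      have h1 := DQC.abs_blockObs_pow_sub_le U hE hE' (Fin.last T) hD hδ0 hn' hσ m₀ 0
      rw [pow_zero, Module.End.one_apply, zero_add] at h1
      have h2 := DQC.abs_blockObs_dqcMap_pow_sub_le U hE hE' hf hf0 hf1 hσ m₀
      refine (abs_sub_le _ _ _).trans ((add_le_add (h1.trans hnoise) (h2.trans hmix)).trans ?_)
      rw [← add_div, add_halves]
    have hp := hclose 1 1 Matrix.PosSemidef.one (by rw [sub_self]; exact Matrix.PosSemidef.zero)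
      (by simp) (by norm_num) le_rfl
    have ha := hclose _ e (DQC.posSemidef_outputEffect U j (!b))
      (DQC.posSemidef_one_sub_outputEffect U j (!b)) he he0 he1
    rw [DQC.clockProb_eq U,
      DQC.errorProb_eq_of_posSemidef U j b (hD.isDensity_pow hσ m₀).1]
    exact DQC.div_le_add_of_abs_sub_le hx hη hκ herr ha hp
  refine ⟨key, fun ρ hρ hfix => ?_⟩
  have hpow : ∀ m : ℕ, (Dt ^ m) ρ = ρ := by
    intro m
    induction m with
    | zero => simp
    | succ m ih => rw [pow_succ', Module.End.mul_apply, ih, hfix]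
  -- A fixed point is its own iterate, so the first part applies at any sufficiently large time.
  have := key ρ hρ ⌈(K₀ + 1) * (N : ℝ) * (T : ℝ) ^ 2 * Real.log T⌉₊ (Nat.le_ceil _)
  rwa [hpow] at this
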